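/- **Conventions.** A *representation* of a set $X$ is a surjective partial map $\delta_X:\subseteq\mathbb{N}^{\mathbb{N}}\to X$; if $\delta_X(p)=x$, then $p$ is a *name* of $x$. A *problem* $f:\subseteq X\rightrightarrows Y$ is a partial multi-valued map between represented spaces, with $\operatorname{dom}(f)=\{x: f(x)\neq\emptyset\}$. A partial map $F:\subseteq\mathbb{N}^{\mathbb{N}}\to\mathbb{N}^{\mathbb{N}}$ *realizes* $f$, written $F\vdash f$, if for every name $p$ of a point $x\in\operatorname{dom}(f)$ the value $F(p)$ is defined and is a name of an element of $f(x)$. Let $\langle p,q\rangle$ be the standard (interleaving) pairing on $\mathbb{N}^{\mathbb{N}}$, and let $\langle n,k\rangle$ be a standard computable pairing bijection on $\mathbb{N}$. Then: - $f\leq_{\mathrm W} g$ ($f$ is *Weihrauch reducible* to $g$) if there are computable $H,K:\subseteq\mathbb{N}^{\mathbb{N}}\to\mathbb{N}^{\mathbb{N}}$ such that for every $G\vdash g$ the map $p\mapsto H\langle p,GK(p)\rangle$ realizes $f$; - $f\leq_{\mathrm{sW}} g$ ($f$ is *strongly Weihrauch reducible* to $g$) if there are computable $H,K:\subseteq\mathbb{N}^{\mathbb{N}}\to\mathbb{N}^{\mathbb{N}}$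 such that for every $G\vdash g$ the map $HGK$ realizes $f$. Two problems are *(strongly) Weihrauch incomparable* if neither is (strongly) Weihrauch reducible to the other. The *jump* $f'$ of $f$ is the same problem, except that the input representation $\delta_X$ is replaced by $\delta_X\circ\lim$, where $\lim:\subseteq\mathbb{N}^{\mathbb{N}}\to\mathbb{N}^{\mathbb{N}}$ maps $p$ to the pointwise limit, as $n\to\infty$, of the sequences $p_n(k)=p\langle n,k\rangle$. Write $k=\{0,\dots,k-1\}$, and let $[\mathbb{N}]^n$ be the set of $n$-element subsets of $\mathbb{N}$. A set $M\subseteq\mathbb{N}$ is *homogeneous* for a coloring $c:[\mathbb{N}]^n\to k$ if $c$ is constant on the $n$-element subsets of $M$. The coloring $c$ is *stable* if $\lim_{i\to\infty}c(A\cup\{i\})$ exists for every $A\in[\mathbb{N}]^{n-1}$. Consider the following problems. - $\mathsf{BWT}_k$: given a sequence $x\in k^{\mathbb{N}}$, find a cluster point of $x$, i.e., some $a\in k$ that occurs infinitely often in $x$. - $\mathsf{RT}_{n,k}$: given a coloring $c:[\mathbb{N}]^n\to k$, find an infinite homogeneous set for $c$. - $\mathsf{SRT}_{n,k}$: the restriction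 of $\mathsf{RT}_{n,k}$ to stable colorings. - $\mathsf{D}_{n,k}:=\mathsf{RT}_{1,k}^{(n-1)}$, the $(n-1)$-fold jump; in particular $\mathsf{D}_{2,2}=\mathsf{RT}_{1,2}'$. Here a sequence in $k^{\mathbb{N}}$ is its own name, $p$ names $a\in k$ if $p(0)=a$, the name of a subset of $\mathbb{N}$ is its characteristic function, and the name of a coloring $c$ is the sequence of the values of $c$ along a standard numbering of $[\mathbb{N}]^n$. **Theorem.** 1. $\mathsf{BWT}_2'\not\leq_{\mathrm W}\mathsf{RT}_{1,2}'$. 2. $\mathsf{BWT}_2'$ and $\mathsf{RT}_{1,2}'$ are Weihrauch incomparable. 3. $\mathsf{BWT}_2$ and $\mathsf{RT}_{1,2}$ are strongly Weihrauch incomparable. 4. $\mathsf{SRT}_{2,2}\not\leq_{\mathrm W}\mathsf{D}_{2,2}$. -/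

import Mathlib

open Filter Topology

namespace WeihrauchRamsey

/-! ### Computable functions on Baire space -/

/-- Baire space. -/
abbrev Baire : Type := ℕ → ℕ

/-- The finite initial segment `p(0), …, p(n-1)` of `p`. -/
def initSeg (p : Baire) (n : ℕ) : List ℕ := (List.range n).map p

/-- A partial function on Baire space is computable if some computable, prefix-monotone function
on finite words approximates it on its domain: on the initial segments of `p ∈ dom F` the word
function produces longer and longer initial segments of `F p`. As usual, nothing is
required outside of the domain of `F`. -/
def IsComputable (F : Baire →. Baire) : Prop :=
  ∃ h : List ℕ → List ℕ, Computable h ∧ (∀ u v, u <+: v → h u <+: h v) ∧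
    ∀ p q, q ∈ F p → ∀ m, ∃ n, initSeg q m <+: h (initSeg p n)

/-- The pairing `⟨p, q⟩` on Baire space: `p` on the even positions, `q` on the odd positions. -/
def bairePair (p q : Baire) : Baire := fun n => if n % 2 = 0 then p (n / 2) else q (n / 2)

/-- The graph of the limit map on Baire space: `p` codes the sequence of the
`p_n = (k ↦ p ⟨n, k⟩)`, and `q` is its pointwise limit. -/
def IsLim (p q : Baire) : Prop := ∀ k, ∀ᶠ n in atTop, p (Nat.pair n k) = q k

theorem IsLim.unique {p q r : Baire} (hq : IsLim p q) (hr : IsLim p r) : q = r := by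
  funext k
  obtain ⟨n, h1, h2⟩ := ((hq k).and (hr k)).exists
  exact h1.symm.trans h2

theorem isLim_const (q : Baire) : IsLim (fun i => q (Nat.unpair i).2) q := by
  intro k
  simp

/-! ### Representations, problems, Weihrauch reducibility -/

/-- A representation of `X`: a surjective partial map from Baire space to `X`,
given by its graph; `names p x` says that `p` is a name of `x`. -/
structure Representation (X : Type) where
  names : Baire → X → Prop
  functional : ∀ p x y, names p x → names p y → x = y
  surjective : ∀ x, ∃ p, names p x

/-- The jump `δ' = δ ∘ lim` of a representation. -/
def Representation.jump {X : Type} (δ : Representation X) : Representation X where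
  names p x := ∃ q, IsLim p q ∧ δ.names q x
  functional := by
    rintro p x y ⟨q, hq, hx⟩ ⟨r, hr, hy⟩
    obtain rfl := hq.unique hr
    exact δ.functional q x y hx hy
  surjective x := by
    obtain ⟨q, hq⟩ := δ.surjective x
    exact ⟨_, q, isLim_const q, hq⟩

/-- A problem: a partial multi-valued function between represented spaces. `sol x` is the set of
solutions of `x`, and the domain consists of the `x` with `sol x ≠ ∅`. -/
structure Problem (X Y : Type) where
  inRep : Representation X
  outRep : Representation Y
  sol : X → Set Y

/-- The jump of a problem: the input representation is replaced by its jump. -/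
def Problem.jump {X Y : Type} (f : Problem X Y) : Problem X Y where
  inRep := f.inRep.jump
  outRep := f.outRep
  sol := f.sol

/-- `F` realizes `f`: on every name of an `x ∈ dom f`, `F` is defined and its value is a
name of a solution of `x`. -/
def Realizes {X Y : Type} (F : Baire →. Baire) (f : Problem X Y) : Prop :=
  ∀ p x, f.inRep.names p x → (f.sol x).Nonempty →
    ∃ q ∈ F p, ∃ y ∈ f.sol x, f.outRep.names q y

/-- Weihrauch reducibility: there are computable `H`, `K` such that `H⟨id, GK⟩` realizes `f`
for every realizer `G` of `g`. -/
def WeihrauchReducible {X Y W Z : Type} (f : Problem X Y) (g : Problem W Z) : Prop :=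
  ∃ H K : Baire →. Baire, IsComputable H ∧ IsComputable K ∧
    ∀ G : Baire →. Baire, Realizes G g →
      Realizes (fun p => (K p).bind fun s => (G s).bind fun r => H (bairePair p r)) f

/-- Strong Weihrauch reducibility: there are computable `H`, `K` such that `HGK` realizes `f`
for every realizer `G` of `g`. -/
def StronglyWeihrauchReducible {X Y W Z : Type} (f : Problem X Y) (g : Problem W Z) : Prop :=
  ∃ H K : Baire →. Baire, IsComputable H ∧ IsComputable K ∧
    ∀ G : Baire →. Baire, Realizes G g →
      Realizes (fun p => (K p).bind fun s => (G s).bind H) f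

/-- Neither problem is Weihrauch reducible to the other. -/
def WeihrauchIncomparable {X Y W Z : Type} (f : Problem X Y) (g : Problem W Z) : Prop :=
  ¬ WeihrauchReducible f g ∧ ¬ WeihrauchReducible g f

/-- Neither problem is strongly Weihrauch reducible to the other. -/
def StronglyWeihrauchIncomparable {X Y W Z : Type} (f : Problem X Y) (g : Problem W Z) : Prop :=
  ¬ StronglyWeihrauchReducible f g ∧ ¬ StronglyWeihrauchReducible g f

/-! ### The represented spaces -/

/-- The space `k = {0, …, k-1}`: `p` is a name of `a` if `p(0) = a`. -/
def finRep (k : ℕ) : Representation (Fin k) where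
  names p a := p 0 = a
  functional _ _ _ hx hy := Fin.ext (hx.symm.trans hy)
  surjective a := ⟨fun _ => a, rfl⟩

/-- The space of sequences in `k = {0, …, k-1}`; every sequence is its own name. -/
def finSeqRep (k : ℕ) : Representation (ℕ → Fin k) where
  names p x := ∀ i, p i = x i
  functional _ _ _ hx hy := funext fun i => Fin.ext ((hx i).symm.trans (hy i))
  surjective x := ⟨fun i => x i, fun _ => rfl⟩

/-- Cantor space, as the space of subsets of `ℕ`; the only name of a set is its
characteristic function. -/
noncomputable def cantorRep : Representation (Set ℕ) where
  names p M := p = M.indicator 1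
  functional p M N hM hN := by
    ext i
    have h := congrFun (hM.symm.trans hN) i
    by_cases h1 : i ∈ M <;> by_cases h2 : i ∈ N <;> simp_all
  surjective M := ⟨_, rfl⟩

/-- The standard numbering of the `n`-element sets of natural numbers: for `n ≥ 1` the number
`⟨i₀, ⟨i₁, … ⟩⟩` is mapped to `{i₀ < i₀ + i₁ + 1 < i₀ + i₁ + i₂ + 2 < …}`. -/
def tupleSet : ℕ → ℕ → Finset ℕ
  | 0, _ => ∅
  | 1, e => {e}
  | n + 2, e =>
    insert (Nat.unpair e).1
      ((tupleSet (n + 1) (Nat.unpair e).2).map (addRightEmbedding ((Nat.unpair e).1 + 1)))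

theorem card_tupleSet : ∀ n e, (tupleSet n e).card = n
  | 0, _ => rfl
  | 1, _ => rfl
  | n + 2, e => by
    rw [tupleSet, Finset.card_insert_of_notMem, Finset.card_map, card_tupleSet]
    simp only [Finset.mem_map, addRightEmbedding_apply, not_exists, not_and]
    intro a _ h
    omega

theorem exists_tupleSet : ∀ (n : ℕ) (A : Finset ℕ), A.card = n → ∃ e, tupleSet n e = A
  | 0, A, h => ⟨0, (Finset.card_eq_zero.1 h).symm⟩
  | 1, A, h => by
    obtain ⟨a, rfl⟩ := Finset.card_eq_one.1 h
    exact ⟨a, rfl⟩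
  | n + 2, A, h => by
    have hne : A.Nonempty := Finset.card_pos.1 (by omega)
    set a := A.min' hne with ha
    have hmem : a ∈ A := A.min'_mem hne
    have hlt : ∀ x ∈ A.erase a, a < x := fun x hx =>
      Finset.min'_lt_of_mem_erase_min' A hne hx
    have hinj : Set.InjOn (fun x => x - (a + 1)) (A.erase a : Set ℕ) := by
      intro x hx y hy hxy
      have h1 := hlt x hx
      have h2 := hlt y hy
      simp only at hxy
      omega
    obtain ⟨e, he⟩ := exists_tupleSet (n + 1) ((A.erase a).image fun x => x - (a + 1)) (by
      rw [Finset.card_image_of_injOn hinj, Finset.card_erase_of_mem hmem, h]; rfl)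
    refine ⟨Nat.pair a e, ?_⟩
    rw [tupleSet, Nat.unpair_pair]
    simp only [he]
    rw [← Finset.insert_erase hmem]
    simp only [Finset.erase_insert_eq_erase, Finset.erase_idem]
    congr 1
    ext x
    simp only [Finset.mem_map, Finset.mem_image, addRightEmbedding_apply]
    constructor
    · rintro ⟨_, ⟨y, hy, rfl⟩, rfl⟩
      have := hlt y hy
      rwa [Nat.sub_add_cancel (by omega)]
    · intro hx
      have := hlt x hx
      exact ⟨_, ⟨x, hx, rfl⟩, Nat.sub_add_cancel (by omega)⟩

/-- The colorings of the `n`-element sets of natural numbers with `k` colors. -/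
abbrev Coloring (n k : ℕ) : Type := {A : Finset ℕ // A.card = n} → Fin k

/-- The space of colorings: `p` is a name of `c` if `p(i)` is the color of the `i`-th
`n`-element set, for every `i`. -/
def coloringRep (n k : ℕ) : Representation (Coloring n k) where
  names p c := ∀ i, p i = c ⟨tupleSet n i, card_tupleSet n i⟩
  functional p c d hc hd := by
    funext ⟨A, hA⟩
    obtain ⟨e, rfl⟩ := exists_tupleSet n A hA
    exact Fin.ext ((hc e).symm.trans (hd e))
  surjective c := ⟨fun i => c ⟨tupleSet n i, card_tupleSet n i⟩, fun _ => rfl⟩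

/-! ### The problems -/

/-- `M` is homogeneous for `c`: all `n`-element subsets of `M` have the same color. -/
def IsHomogeneous {n k : ℕ} (c : Coloring n k) (M : Set ℕ) : Prop :=
  ∃ a : Fin k, ∀ A : {A : Finset ℕ // A.card = n}, (A.1 : Set ℕ) ⊆ M → c A = a

/-- `c` is stable: for every `(n-1)`-element set `A`, the color of `A ∪ {i}` is eventually
constant as `i → ∞` (where `i ∉ A`). -/
def IsStable {n k : ℕ} (c : Coloring n k) : Prop :=
  ∀ A : Finset ℕ, A.card + 1 = n →
    ∃ a : Fin k, ∀ᶠ i in atTop, ∀ h : (insert i A).card = n, c ⟨insert i A, h⟩ = a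

/-- The Bolzano-Weierstrass theorem for the discrete space `k`: given a sequence in `k`, find a
cluster point. -/
def BWT (k : ℕ) : Problem (ℕ → Fin k) (Fin k) where
  inRep := finSeqRep k
  outRep := finRep k
  sol x := {a | MapClusterPt a atTop x}

/-- Ramsey's theorem for cardinality `n` and `k` colors: given a coloring, find
an infinite homogeneous set. -/
noncomputable def RT (n k : ℕ) : Problem (Coloring n k) (Set ℕ) where
  inRep := coloringRep n k
  outRep := cantorRep
  sol c := {M | M.Infinite ∧ IsHomogeneous c M}

/-- Stable Ramsey's theorem: the restriction of Ramsey's theorem to stable colorings. -/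
noncomputable def SRT (n k : ℕ) : Problem (Coloring n k) (Set ℕ) where
  inRep := coloringRep n k
  outRep := cantorRep
  sol c := {M | IsStable c ∧ M ∈ (RT n k).sol c}

/-- The problem `D_{n,k}` (for `n ≥ 1`): the `(n-1)`-fold jump of Ramsey's theorem for
cardinality `1` and `k` colors. -/
noncomputable def D (n k : ℕ) : Problem (Coloring 1 k) (Set ℕ) :=
  Problem.jump^[n - 1] (RT 1 k)

end WeihrauchRamsey

namespace WeihrauchRamsey

/-! ### Continuity of computable functions -/

/-! Computability is used only through continuity, and for the strong reductions not even that.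

The negative results on `(BWT 2).jump` and `SRT 2 2` both rest on `false_of_clusterPt_from_mono`.
Names of a binary limit x are parametrized by sequences through `limName`; a condition fixes
finitely many entries of the parameter, and at a generic parameter each single color of the produced
coloring is decided by a condition. Suppose first that every condition extends, with any constant
tail of x, so that a given color occurs infinitely often. The answer on a monochromatic set depends
on finite data; extend those data with the tail opposite to the answer, completing the finite part
of the set by infinitely many numbers of its color. The answer is then wrong
(`false_of_frequently_colors`). Otherwise, below some condition with x of tail a fixed, a color i
always occurs finitely often, and category gives a smaller condition and an N beyond which no color
i can be forced. Switch the tail to a' ≠ a, obtain the answer a' from a set beyond N, and hide the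
part of the name already read as filler of a name of the old x. For a generic such name the whole
set has the color other than i, so the answer a' persists, wrongly (`false_of_eventually_ne_color`).

Conversely, `BWT` returns one bit. For some fixed bit and color the successful inputs are somewhere
dense, yet an output that has committed to j can be met by a change of the j-th limit. For strong
reductions, two colorings share an infinite homogeneous set, and two bits yield at most two
candidate sets. -/

/-- `F` is continuous on its domain: finitely many values of `F p` are determined by finitely many
values of `p`. -/
def LocallyDetermined (F : Baire →. Baire) : Prop :=
  ∀ p q, q ∈ F p → ∀ m, ∃ n, ∀ p' q', (∀ i < n, p' i = p i) → q' ∈ F p' → ∀ i < m, q' i = q i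

theorem initSeg_congr {p q : Baire} {n : ℕ} (h : ∀ i < n, p i = q i) :
    initSeg p n = initSeg q n :=
  List.map_congr_left fun i hi => h i (List.mem_range.1 hi)

theorem initSeg_inj {p q : Baire} {n : ℕ} (h : initSeg p n = initSeg q n) :
    ∀ i < n, p i = q i := fun i hi =>
  List.map_inj_left.1 h i (List.mem_range.2 hi)

theorem length_initSeg (p : Baire) (n : ℕ) : (initSeg p n).length = n := by
  simp [initSeg]

theorem initSeg_prefix (p : Baire) {m n : ℕ} (h : m ≤ n) : initSeg p m <+: initSeg p n := by
  obtain ⟨k, rfl⟩ := Nat.exists_eq_add_of_le h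
  simp [initSeg, List.range_add]

theorem IsComputable.locallyDetermined {F : Baire →. Baire} (hF : IsComputable F) :
    LocallyDetermined F := by
  obtain ⟨h, -, hmono, hF⟩ := hF
  intro p q hq m
  obtain ⟨n, hn⟩ := hF p q hq m
  refine ⟨n, fun p' q' hp hq' => ?_⟩
  obtain ⟨n', hn'⟩ := hF p' q' hq' m
  have h1 : initSeg q m <+: h (initSeg p' (max n n')) := by
    rw [← initSeg_congr hp] at hn
    exact hn.trans (hmono _ _ (initSeg_prefix p' (le_max_left _ _)))
  have h2 := hn'.trans (hmono _ _ (initSeg_prefix p' (le_max_right n n')))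
  have h3 := List.prefix_of_prefix_length_le h2 h1 (by simp [length_initSeg])
  exact initSeg_inj (h3.eq_of_length (by simp [length_initSeg]))

theorem bairePair_congr {p p' r r' : Baire} {n : ℕ} (hp : ∀ i < n, p' i = p i)
    (hr : ∀ i < n, r' i = r i) : ∀ i < n, bairePair p' r' i = bairePair p r i := by
  intro i hi
  simp only [bairePair]
  rw [hp (i / 2) (by omega), hr (i / 2) (by omega)]

/-! ### Reductions, without realizers -/

section Realizers

variable {X Y W Z : Type} {f : Problem X Y} {g : Problem W Z}

open Classical in
/-- A realizer that is defined exactly on the names of the instances. -/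
theorem exists_realizer (g : Problem W Z) :
    ∃ G : Baire →. Baire, Realizes G g ∧
      ∀ s r, r ∈ G s → ∃ w, g.inRep.names s w ∧ (g.sol w).Nonempty := by
  have key : ∀ s, (∃ w, g.inRep.names s w ∧ (g.sol w).Nonempty) →
      ∃ r, ∀ w, g.inRep.names s w → ∃ y ∈ g.sol w, g.outRep.names r y := by
    rintro s ⟨w, hw, y, hy⟩
    obtain ⟨r, hr⟩ := g.outRep.surjective y
    refine ⟨r, fun w' hw' => ?_⟩
    obtain rfl := g.inRep.functional _ _ _ hw hw'
    exact ⟨y, hy, hr⟩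
  refine ⟨fun s => ⟨∃ w, g.inRep.names s w ∧ (g.sol w).Nonempty,
    fun h => (key s h).choose⟩, ?_, ?_⟩
  · intro s w hw hne
    exact ⟨_, ⟨⟨w, hw, hne⟩, rfl⟩, (key s ⟨w, hw, hne⟩).choose_spec w hw⟩
  · rintro s r ⟨h, -⟩
    exact h

open Classical in
/-- A realizer may return any name of any solution on a given name of an instance. -/
theorem exists_realizer_eq (g : Problem W Z) {s r : Baire} {w : W} {y : Z}
    (hs : g.inRep.names s w) (hy : y ∈ g.sol w) (hr : g.outRep.names r y) :
    ∃ G : Baire →. Baire, Realizes G g ∧ ∀ r' ∈ G s, r' = r := by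
  obtain ⟨G, hG, -⟩ := exists_realizer g
  refine ⟨fun s' => if s' = s then Part.some r else G s', fun s' w' hw' hne => ?_, by simp⟩
  by_cases h : s' = s
  · subst h
    obtain rfl := g.inRep.functional _ _ _ hs hw'
    exact ⟨r, by simp, y, hy, hr⟩
  · simpa only [if_neg h] using hG s' w' hw' hne

/-- A realizer defined only on names of solvable instances forces `K p` to be such a name. Altering
a realizer at this one name then allows any name of any solution as the answer. -/
theorem exists_instance_of_realizes {K : Baire →. Baire} {H : Baire → Baire →. Baire}
    (h : ∀ G, Realizes G g →
      Realizes (fun p => (K p).bind fun s => (G s).bind fun r => H p r) f)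
    {p : Baire} {x : X} (hp : f.inRep.names p x) (hx : (f.sol x).Nonempty) :
    ∃ s ∈ K p, ∃ w, g.inRep.names s w ∧ (g.sol w).Nonempty ∧
      ∀ y ∈ g.sol w, ∀ r, g.outRep.names r y →
        ∃ t ∈ H p r, ∃ y' ∈ f.sol x, f.outRep.names t y' := by
  obtain ⟨G, hG, hdom⟩ := exists_realizer g
  obtain ⟨t, ht, -⟩ := h G hG p x hp hx
  obtain ⟨s, hs, ht⟩ := Part.mem_bind_iff.1 ht
  obtain ⟨r, hr, -⟩ := Part.mem_bind_iff.1 ht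
  obtain ⟨w, hw, hne⟩ := hdom s r hr
  refine ⟨s, hs, w, hw, hne, fun y hy r hr => ?_⟩
  obtain ⟨G', hG', hr'⟩ := exists_realizer_eq g hw hy hr
  obtain ⟨t, ht, hsol⟩ := h G' hG' p x hp hx
  obtain ⟨s', hs', ht⟩ := Part.mem_bind_iff.1 ht
  obtain rfl := Part.mem_unique hs hs'
  obtain ⟨r₁, h₁, ht⟩ := Part.mem_bind_iff.1 ht
  obtain rfl := hr' r₁ h₁
  exact ⟨t, ht, hsol⟩

theorem WeihrauchReducible.exists_locallyDetermined (h : WeihrauchReducible f g) :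
    ∃ H K : Baire →. Baire, LocallyDetermined H ∧ LocallyDetermined K ∧
      ∀ p x, f.inRep.names p x → (f.sol x).Nonempty →
        ∃ s ∈ K p, ∃ w, g.inRep.names s w ∧ (g.sol w).Nonempty ∧
          ∀ y ∈ g.sol w, ∀ r, g.outRep.names r y →
            ∃ t ∈ H (bairePair p r), ∃ y' ∈ f.sol x, f.outRep.names t y' := by
  obtain ⟨H, K, hH, hK, h⟩ := h
  exact ⟨H, K, hH.locallyDetermined, hK.locallyDetermined, fun p x hp hx =>
    exists_instance_of_realizes (H := fun p r => H (bairePair p r)) h hp hx⟩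

theorem StronglyWeihrauchReducible.exists_forall (h : StronglyWeihrauchReducible f g) :
    ∃ H K : Baire →. Baire,
      ∀ p x, f.inRep.names p x → (f.sol x).Nonempty →
        ∃ s ∈ K p, ∃ w, g.inRep.names s w ∧ (g.sol w).Nonempty ∧
          ∀ y ∈ g.sol w, ∀ r, g.outRep.names r y →
            ∃ t ∈ H r, ∃ y' ∈ f.sol x, f.outRep.names t y' := by
  obtain ⟨H, K, -, -, h⟩ := h
  exact ⟨H, K, fun p x hp hx => exists_instance_of_realizes (H := fun _ r => H r) h hp hx⟩

end Realizers

/-! ### Sequences in two colors -/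

theorem exists_infinite_color {k : ℕ} {S : Set ℕ} (hS : S.Infinite) (d : ℕ → Fin k) :
    ∃ b, {j ∈ S | d j = b}.Infinite := by
  by_contra! h
  have h : ∀ b, {j ∈ S | d j = b}.Finite := fun b => by simpa using h b
  refine hS ((Set.finite_iUnion h).subset fun j hj => ?_)
  simp [hj]

theorem mapClusterPt_iff_frequently_eq {k : ℕ} {x : ℕ → Fin k} {a : Fin k} :
    MapClusterPt a atTop x ↔ ∃ᶠ i in atTop, x i = a := by
  rw [mapClusterPt_iff_frequently]
  constructor
  · intro h
    exact h {a} (by simp)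
  · intro h s hs
    exact h.mono fun i hi => hi ▸ mem_of_mem_nhds hs

theorem BWT_sol_nonempty {k : ℕ} (x : ℕ → Fin k) : ((BWT k).sol x).Nonempty := by
  obtain ⟨b, hb⟩ := exists_infinite_color Set.infinite_univ x
  refine ⟨b, mapClusterPt_iff_frequently_eq.2 (Nat.frequently_atTop_iff_infinite.2 ?_)⟩
  simpa using hb

/-! ### Baire category on spaces of limit names -/

theorem exists_agree_subset_of_isOpen {α : Type*} [TopologicalSpace α] [DiscreteTopology α]
    {U : Set (ℕ → α)} (hU : IsOpen U) {y : ℕ → α} (hy : y ∈ U) :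
    ∃ n, ∀ y', (∀ i < n, y' i = y i) → y' ∈ U := by
  obtain ⟨_, ⟨x, n, rfl⟩, hx, h⟩ :=
    (PiNat.isTopologicalBasis_cylinders fun _ => α).exists_subset_of_mem_open hy hU
  refine ⟨n, fun y' h' => h fun i hi => ?_⟩
  rw [h' i hi]
  exact hx i hi

theorem isOpen_setOf_agree {α : Type*} [TopologicalSpace α] [DiscreteTopology α]
    (y : ℕ → α) (n : ℕ) : IsOpen {y' : ℕ → α | ∀ i < n, y' i = y i} :=
  PiNat.isOpen_cylinder (fun _ => α) y n

theorem continuous_of_agree {α β : Type*} [TopologicalSpace α] [DiscreteTopology α]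
    [TopologicalSpace β] {F : (ℕ → α) → β}
    (h : ∀ y, ∃ n, ∀ y', (∀ i < n, y' i = y i) → F y' = F y) : Continuous F := by
  refine IsLocallyConstant.continuous ((IsLocallyConstant.iff_exists_open F).2 fun y => ?_)
  obtain ⟨n, hn⟩ := h y
  exact ⟨_, isOpen_setOf_agree y n, fun _ _ => rfl, hn⟩

theorem eq_of_mem_interior_fiber {T β : Type*} [TopologicalSpace T] {d : T → β} {b : β} {t : T}
    (h : t ∈ interior {t | d t = b}) : d t = b := by
  have h' : t ∈ {t | d t = b} := interior_subset h
  exact h'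

/-- A pointwise limit of continuous functions into a countable discrete space is locally constant
on a dense open set. -/
theorem dense_iUnion_interior_fiber {T β : Type*} [TopologicalSpace T] [BaireSpace T]
    [TopologicalSpace β] [DiscreteTopology β] [Countable β] {s : ℕ → T → β} {d : T → β}
    (hs : ∀ n, Continuous (s n)) (hd : ∀ t, ∀ᶠ n in atTop, s n t = d t) :
    Dense (⋃ b, interior {t | d t = b}) := by
  -- The closed set for `q` consists of the points whose approximations equal `q.2` from stage `q.1`
  -- on.
  have hdense := dense_iUnion_interior_of_closed
    (f := fun q : ℕ × β => {t | ∀ n ≥ q.1, s n t = q.2}) (fun q => by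
      simp only [Set.ofPred_forall]
      exact isClosed_iInter fun n => isClosed_iInter fun _ =>
        (isClosed_discrete {q.2}).preimage (hs n)) (by
      refine Set.eq_univ_of_forall fun t => ?_
      obtain ⟨N, hN⟩ := eventually_atTop.1 (hd t)
      exact Set.mem_iUnion.2 ⟨(N, d t), hN⟩)
  refine hdense.mono (Set.iUnion_subset fun q => ?_)
  refine Set.Subset.trans (interior_mono fun t ht => ?_) 
    (Set.subset_iUnion (fun b => interior {t | d t = b}) q.2)
  obtain ⟨n, h1, h2⟩ := ((hd t).and (eventually_ge_atTop q.1)).exists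
  exact h1.symm.trans (ht n h2)

theorem dense_iInter_iUnion_interior_fiber {T β : Type*} [TopologicalSpace T] [BaireSpace T]
    [TopologicalSpace β] [DiscreteTopology β] [Countable β] {s : ℕ → ℕ → T → β} {d : T → ℕ → β}
    (hs : ∀ n j, Continuous (s n j)) (hd : ∀ t j, ∀ᶠ n in atTop, s n j t = d t j) :
    Dense (⋂ j, ⋃ b, interior {t | d t j = b}) :=
  dense_iInter_of_isOpen (fun _ => isOpen_iUnion fun _ => isOpen_interior) fun j =>
    dense_iUnion_interior_fiber (fun n => hs n j) fun t => hd t j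

/-- The name, with respect to the jump, of the sequence `x` that is `x k` at the positions
`⟨n, k⟩ ≥ (y k).1` of the `k`-th column, and is filled up with the `(y i).2`. -/
def limName (x : ℕ → Fin 2) (y : ℕ → ℕ × ℕ) : Baire := fun i =>
  if (y i.unpair.2).1 ≤ i then x i.unpair.2 else (y i).2

theorem isLim_limName (x : ℕ → Fin 2) (y : ℕ → ℕ × ℕ) :
    IsLim (limName x y) (fun k => x k) := by
  intro k
  filter_upwards [eventually_ge_atTop (y k).1] with n hn
  simp [limName, hn.trans (Nat.left_le_pair n k)]

/-- The column of position `i` is at most `i`, so equally long initial segments suffice. The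
converse fails, since a name can show filler instead of the limit; the diagonalizations exploit
this. -/
theorem limName_congr {x x' : ℕ → Fin 2} {y y' : ℕ → ℕ × ℕ} {n : ℕ}
    (hx : ∀ i < n, x' i = x i) (hy : ∀ i < n, y' i = y i) :
    ∀ i < n, limName x' y' i = limName x y i := by
  intro i hi
  have h := (Nat.unpair_right_le i).trans_lt hi
  simp only [limName, hx _ h, hy _ h, hy i hi]

/-- `p` names a sequence in `{0, 1}` with respect to the jump. -/
def NamesBinaryLimit (p : Baire) : Prop := ∃ x : ℕ → Fin 2, IsLim p (fun k => x k)

theorem namesBinaryLimit_limName (x : ℕ → Fin 2) (y : ℕ → ℕ × ℕ) :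
    NamesBinaryLimit (limName x y) := ⟨x, isLim_limName x y⟩

/-- `M` is infinite and monochromatic of color `b` for the coloring `d` of the numbers. -/
def InfMono (d : ℕ → Fin 2) (M : Set ℕ) (b : Fin 2) : Prop := M.Infinite ∧ ∀ j ∈ M, d j = b

theorem exists_infMono (d : ℕ → Fin 2) (N : ℕ) :
    ∃ M b, InfMono d M b ∧ ∀ j ∈ M, N ≤ j := by
  obtain ⟨b, hb⟩ := exists_infinite_color (Set.Ici_infinite N) d
  exact ⟨_, b, ⟨hb, fun j hj => hj.2⟩, fun j hj => hj.1⟩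

theorem exists_ne_fin_two (a : Fin 2) : ∃ a' : Fin 2, a' ≠ a := exists_ne a

theorem eq_of_ne_fin_two {a b c : Fin 2} (h : b ≠ a) (h' : c ≠ a) : b = c := by omega

/-- A frequently attained value of an eventually constant sequence. -/
theorem eq_of_frequently_of_tail {x : ℕ → Fin 2} {a b : Fin 2} {n : ℕ}
    (h : ∃ᶠ k in atTop, x k = b) (hx : ∀ k, n ≤ k → x k = a) : b = a := by
  obtain ⟨k, h1, h2⟩ := (h.and_eventually (eventually_ge_atTop n)).exists
  exact h1.symm.trans (hx k h2)

section Main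

variable {F : Baire → Baire} {c : Baire → ℕ → Fin 2} {A : Baire → Set ℕ → Fin 2 → Fin 2}

/-- Used with both parameters varying and with `x` fixed and only `y` varying. -/
theorem continuous_comp_limName {α : Type*} [TopologicalSpace α] [DiscreteTopology α]
    (hF : ∀ p, NamesBinaryLimit p → ∀ m, ∃ n, ∀ p', NamesBinaryLimit p' →
      (∀ i < n, p' i = p i) → F p' m = F p m)
    (u : (ℕ → α) → ℕ → Fin 2) (v : (ℕ → α) → ℕ → ℕ × ℕ)
    (huv : ∀ z z' : ℕ → α, ∀ i, z' i = z i → u z' i = u z i ∧ v z' i = v z i) (m : ℕ) :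
    Continuous fun z => F (limName (u z) (v z)) m := by
  refine continuous_of_agree fun z => ?_
  obtain ⟨n, hn⟩ := hF _ (namesBinaryLimit_limName (u z) (v z)) m
  exact ⟨n, fun z' hz => hn _ (namesBinaryLimit_limName _ _)
    (limName_congr (fun i hi => (huv z z' i (hz i hi)).1) fun i hi => (huv z z' i (hz i hi)).2)⟩

/-- The case in which both colors can still occur infinitely often below each condition. -/
theorem false_of_frequently_colors
    (hc : ∀ p, NamesBinaryLimit p → IsLim (F p) (fun k => c p k))
    (hF : ∀ p, NamesBinaryLimit p → ∀ m, ∃ n, ∀ p', NamesBinaryLimit p' →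
      (∀ i < n, p' i = p i) → F p' m = F p m)
    (hA : ∀ p (x : ℕ → Fin 2) M b, IsLim p (fun k => x k) → InfMono (c p) M b →
      ∃ᶠ k in atTop, x k = A p M b)
    (hA' : ∀ p M b, NamesBinaryLimit p → InfMono (c p) M b → ∃ n, ∀ p' M' b',
      NamesBinaryLimit p' → InfMono (c p') M' b' → (∀ i < n, p' i = p i) →
      (∀ i < n, i ∈ M' ↔ i ∈ M) → A p' M' b' = A p M b)
    (h : ∀ (z : ℕ → Fin 2 × ℕ × ℕ) n a i, ∃ z' : ℕ → Fin 2 × ℕ × ℕ, (∀ k < n, z' k = z k) ∧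
      (∀ k, n ≤ k → (z' k).1 = a) ∧
      ∃ᶠ j in atTop, c (limName (fun k => (z' k).1) (fun k => (z' k).2)) j = i) :
    False := by
  let nm : (ℕ → Fin 2 × ℕ × ℕ) → Baire := fun z => limName (fun k => (z k).1) (fun k => (z k).2)
  have hnm : ∀ z, NamesBinaryLimit (nm z) := fun z => namesBinaryLimit_limName _ _
  have hdense := dense_iInter_iUnion_interior_fiber (β := ℕ)
    (s := fun n j z => F (nm z) (Nat.pair n j)) (d := fun z j => (c (nm z) j : ℕ))
    (fun n j => continuous_comp_limName hF _ _ (by simp +contextual) _)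
    (fun z j => hc _ (hnm z) j)
  obtain ⟨z, hz⟩ := hdense.nonempty
  have hloc : ∀ j, ∃ n, ∀ z', (∀ i < n, z' i = z i) → c (nm z') j = c (nm z) j := by
    intro j
    obtain ⟨b, hb⟩ := Set.mem_iUnion.1 (Set.mem_iInter.1 hz j)
    obtain ⟨n, hn⟩ := exists_agree_subset_of_isOpen isOpen_interior hb
    refine ⟨n, fun z' hz' => Fin.ext ?_⟩
    have h1 : (c (nm z') j : ℕ) = b := (eq_of_mem_interior_fiber (hn z' hz') :)
    have h2 : (c (nm z) j : ℕ) = b := (eq_of_mem_interior_fiber hb :)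
    exact h1.trans h2.symm
  choose l hl using hloc
  obtain ⟨M, b, hM, -⟩ := exists_infMono (c (nm z)) 0
  obtain ⟨n, hn⟩ := hA' _ M b (hnm z) hM
  obtain ⟨a, ha⟩ := exists_ne_fin_two (A (nm z) M b)
  obtain ⟨z', hz', htail, hfreq⟩ := h z (max n ((Finset.range n).sup l)) a b
  -- Below the use `n` the condition decides the colors, so `M` is kept there; the recurring color
  -- `b` supplies the infinite rest.
  have hM' : InfMono (c (nm z')) {j | j < n ∧ j ∈ M ∨ n ≤ j ∧ c (nm z') j = b} b := by
    constructor
    · refine (Nat.frequently_atTop_iff_infinite.1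
        (hfreq.and_eventually (eventually_ge_atTop n))).mono fun j hj => Or.inr ⟨hj.2, hj.1⟩
    · rintro j (⟨hj, hjM⟩ | hj)
      · rw [hl j z' fun i hi => hz' i (hi.trans_le ?_)]
        · exact hM.2 j hjM
        · exact (Finset.le_sup (Finset.mem_range.2 hj)).trans (le_max_right _ _)
      · exact hj.2
  have hz'n : ∀ i < n, z' i = z i := fun i hi => hz' i (hi.trans_le (le_max_left _ _))
  have h1 := hn _ _ b (hnm z') hM'
    (limName_congr (fun i hi => by rw [hz'n i hi]) fun i hi => by rw [hz'n i hi])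
    (fun i hi => by simp [hi, not_le.2 hi])
  have h2 := eq_of_frequently_of_tail (hA _ _ _ b (isLim_limName _ _) hM') htail
  exact ha (h2.symm.trans h1)

/-- The case in which below some condition with a fixed limit one color occurs only finitely
often. -/
theorem false_of_eventually_ne_color
    (hc : ∀ p, NamesBinaryLimit p → IsLim (F p) (fun k => c p k))
    (hF : ∀ p, NamesBinaryLimit p → ∀ m, ∃ n, ∀ p', NamesBinaryLimit p' →
      (∀ i < n, p' i = p i) → F p' m = F p m)
    (hA : ∀ p (x : ℕ → Fin 2) M b, IsLim p (fun k => x k) → InfMono (c p) M b →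
      ∃ᶠ k in atTop, x k = A p M b)
    (hA' : ∀ p M b, NamesBinaryLimit p → InfMono (c p) M b → ∃ n, ∀ p' M' b',
      NamesBinaryLimit p' → InfMono (c p') M' b' → (∀ i < n, p' i = p i) →
      (∀ i < n, i ∈ M' ↔ i ∈ M) → A p' M' b' = A p M b)
    {x : ℕ → Fin 2} {y : ℕ → ℕ × ℕ} {n : ℕ} {a i : Fin 2} (hx : ∀ k, n ≤ k → x k = a)
    (h : ∀ y' : ℕ → ℕ × ℕ, (∀ k < n, y' k = y k) → ∀ᶠ j in atTop, c (limName x y') j ≠ i) :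
    False := by
  have hdense := dense_iInter_iUnion_interior_fiber (β := ℕ)
    (s := fun n j y => F (limName x y) (Nat.pair n j)) (d := fun y j => (c (limName x y) j : ℕ))
    (fun n j => continuous_comp_limName hF _ _ (by simp +contextual) _)
    (fun y j => hc _ (namesBinaryLimit_limName x y) j)
  -- a smaller condition and a uniform bound `N`
  let O : ℕ → Set (ℕ → ℕ × ℕ) := fun j => interior {y' | (c (limName x y') j : ℕ) = i}
  -- The `N`-th set says that no `j ≥ N` is locally forced to color `i`; parameters outside the
  -- condition are added to obtain a cover.
  have hcover := dense_iUnion_interior_of_closed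
    (f := fun N => {y' : ℕ → ℕ × ℕ | ∀ k < n, y' k = y k}ᶜ ∪ ⋂ j, ⋂ (_ : N ≤ j), (O j)ᶜ)
    (fun N => (isOpen_setOf_agree y n).isClosed_compl.union
      (isClosed_iInter fun j => isClosed_iInter fun _ => isOpen_interior.isClosed_compl)) (by
    refine Set.eq_univ_of_forall fun y' => ?_
    by_cases hy' : ∀ k < n, y' k = y k
    · obtain ⟨N, hN⟩ := eventually_atTop.1 (h y' hy')
      refine Set.mem_iUnion.2 ⟨N, Or.inr (Set.mem_iInter₂.2 fun j hj hO => hN j hj ?_)⟩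
      exact Fin.ext (eq_of_mem_interior_fiber hO :)
    · exact Set.mem_iUnion.2 ⟨0, Or.inl hy'⟩)
  obtain ⟨y₀, hy₀, hy₀'⟩ := hcover.inter_open_nonempty _ (isOpen_setOf_agree y n)
    ⟨y, fun _ _ => rfl⟩
  obtain ⟨N, hN⟩ := Set.mem_iUnion.1 hy₀'
  obtain ⟨l, hl⟩ := exists_agree_subset_of_isOpen isOpen_interior hN
  have hnl : n ≤ max n l := le_max_left n l
  have hO : ∀ y', (∀ k < max n l, y' k = y₀ k) → ∀ j, N ≤ j → y' ∉ O j := by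
    intro y' hy' j hj
    rcases interior_subset (hl y' fun k hk => hy' k (hk.trans_le (le_max_right _ _))) with h1 | h1
    · exact absurd (fun k hk => (hy' k (hk.trans_le hnl)).trans (hy₀ k hk)) h1
    · exact Set.mem_iInter₂.1 h1 j hj
  generalize max n l = L at hnl hO
  -- change the limit, and change it back once the answer is determined
  obtain ⟨a', ha'⟩ := exists_ne_fin_two a
  let x₁ : ℕ → Fin 2 := fun k => if k < L then x k else a'
  -- The color `b` is irrelevant: `hA'` permits `M` to have another color for another name.
  obtain ⟨M, b, hM, hMN⟩ := exists_infMono (c (limName x₁ y₀)) N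
  have hAM : A (limName x₁ y₀) M b = a' :=
    eq_of_frequently_of_tail (hA _ _ _ _ (isLim_limName x₁ y₀) hM) (n := L)
      fun k hk => by simp [x₁, not_lt.2 hk]
  obtain ⟨m, hm⟩ := hA' _ M b (namesBinaryLimit_limName x₁ y₀) hM
  -- Threshold `m` in the columns from `L` on leaves room to copy the name with the switched tail
  -- below `m`; in the columns below `L` the limits agree anyway.
  let y₁ : ℕ → ℕ × ℕ := fun k =>
    (if k < L then (y₀ k).1 else m, if k.unpair.2 < L then (y₀ k).2 else limName x₁ y₀ k)
  have hy₁ : ∀ k < L, y₁ k = y₀ k := fun k hk => by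
    simp [y₁, hk, (Nat.unpair_right_le k).trans_lt hk]
  have hname : ∀ k < m, limName x y₁ k = limName x₁ y₀ k := by
    intro k hk
    by_cases hkL : k.unpair.2 < L
    · simp [limName, y₁, x₁, hkL]
    · simp [limName, y₁, hkL, not_le.2 hk]
  obtain ⟨y₂, hy₂, hgen⟩ := hdense.inter_open_nonempty _ (isOpen_setOf_agree y₁ (max L m))
    ⟨y₁, fun _ _ => rfl⟩
  -- At a generic parameter an attained color is locally forced.
  have hne : ∀ j, N ≤ j → c (limName x y₂) j ≠ i := by
    intro j hj hji
    obtain ⟨b', hb'⟩ := Set.mem_iUnion.1 (Set.mem_iInter.1 hgen j)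
    have hb : (c (limName x y₂) j : ℕ) = b' := (eq_of_mem_interior_fiber hb' :)
    rw [← hb, hji] at hb'
    exact hO y₂ (fun k hk => (hy₂ k (hk.trans_le (le_max_left _ _))).trans (hy₁ k hk)) j hj hb'
  obtain ⟨b', hb'⟩ := exists_ne_fin_two i
  have hM₂ : InfMono (c (limName x y₂)) M b' :=
    ⟨hM.1, fun j hj => eq_of_ne_fin_two (hne j (hMN j hj)) hb'⟩
  have h1 := hm _ M b' (namesBinaryLimit_limName x y₂) hM₂ (fun k hk => (limName_congr
    (fun _ _ => rfl) (fun k hk => hy₂ k (hk.trans_le (le_max_right _ _))) k hk).trans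
      (hname k hk)) fun _ _ => Iff.rfl
  have h2 := eq_of_frequently_of_tail (hA _ _ _ _ (isLim_limName x y₂) hM₂) hx
  exact ha' (hAM.symm.trans (h1.symm.trans h2))

/-- One cannot continuously transform the names of binary limits into names of limits of
colorings in such a way that the infinite monochromatic sets of the latter continuously determine
a cluster point of the former. -/
theorem false_of_clusterPt_from_mono
    (hc : ∀ p, NamesBinaryLimit p → IsLim (F p) (fun k => c p k))
    (hF : ∀ p, NamesBinaryLimit p → ∀ m, ∃ n, ∀ p', NamesBinaryLimit p' →
      (∀ i < n, p' i = p i) → F p' m = F p m)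
    (hA : ∀ p (x : ℕ → Fin 2) M b, IsLim p (fun k => x k) → InfMono (c p) M b →
      ∃ᶠ k in atTop, x k = A p M b)
    (hA' : ∀ p M b, NamesBinaryLimit p → InfMono (c p) M b → ∃ n, ∀ p' M' b',
      NamesBinaryLimit p' → InfMono (c p') M' b' → (∀ i < n, p' i = p i) →
      (∀ i < n, i ∈ M' ↔ i ∈ M) → A p' M' b' = A p M b) :
    False := by
  refine false_of_frequently_colors hc hF hA hA' ?_
  by_contra hneg
  push Not at hneg
  obtain ⟨z, n, a, i, hneg⟩ := hneg
  -- The failing condition keeps its bits below `n` and receives the tail `a`; only the filler and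
  -- thresholds stay free.
  refine false_of_eventually_ne_color hc hF hA hA' (x := fun k => if k < n then (z k).1 else a)
    (y := fun k => (z k).2) (n := n) (a := a) (i := i)
    (fun k hk => by simp [not_lt.2 hk]) fun y' hy' => ?_
  have h := hneg (fun k => (if k < n then (z k).1 else a, y' k))
    (fun k hk => by simp [hk, hy' k hk]) (fun k hk => by simp [not_lt.2 hk])
  simpa using h

end Main

/-! ### Colorings of numbers -/

/-- The coloring of the numbers given by a coloring of the one-element sets. -/
def Coloring.toSeq {k : ℕ} (w : Coloring 1 k) (j : ℕ) : Fin k := w ⟨{j}, Finset.card_singleton j⟩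

theorem isHomogeneous_one_iff {k : ℕ} {w : Coloring 1 k} {M : Set ℕ} :
    IsHomogeneous w M ↔ ∃ b, ∀ j ∈ M, w.toSeq j = b := by
  refine exists_congr fun b => ⟨fun h j hj => h _ (by simpa using hj), fun h => ?_⟩
  rintro ⟨A, hA⟩ hAM
  obtain ⟨j, rfl⟩ := Finset.card_eq_one.1 hA
  exact h j (by simpa using hAM)

theorem InfMono.mem_RT_sol {w : Coloring 1 2} {M : Set ℕ} {b : Fin 2}
    (h : InfMono w.toSeq M b) : M ∈ (RT 1 2).sol w :=
  ⟨h.1, isHomogeneous_one_iff.2 ⟨b, h.2⟩⟩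

theorem RT_one_sol_nonempty (w : Coloring 1 2) : ((RT 1 2).sol w).Nonempty := by
  obtain ⟨M, b, h, -⟩ := exists_infMono w.toSeq 0
  exact ⟨M, h.mem_RT_sol⟩

/-- The coloring of the one-element sets given by a sequence. -/
def coloringOfSeq {k : ℕ} (x : ℕ → Fin k) : Coloring 1 k := fun A => x (A.1.sup id)

theorem toSeq_coloringOfSeq {k : ℕ} (x : ℕ → Fin k) : (coloringOfSeq x).toSeq = x := by
  funext j
  simp [Coloring.toSeq, coloringOfSeq]

theorem coloringRep_one_names_iff {k : ℕ} {p : Baire} {w : Coloring 1 k} :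
    (coloringRep 1 k).names p w ↔ p = fun j => (w.toSeq j : ℕ) :=
  ⟨fun h => funext h, fun h => congrFun h⟩

theorem RT_one_jump_names_iff {p : Baire} {w : Coloring 1 2} :
    (RT 1 2).jump.inRep.names p w ↔ IsLim p fun j => w.toSeq j :=
  ⟨fun ⟨_, h, hw⟩ => (coloringRep_one_names_iff.1 hw) ▸ h,
    fun h => ⟨_, h, coloringRep_one_names_iff.2 rfl⟩⟩

theorem BWT_jump_names_iff {k : ℕ} {p : Baire} {x : ℕ → Fin k} :
    (BWT k).jump.inRep.names p x ↔ IsLim p fun j => x j :=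
  ⟨fun ⟨_, h, hx⟩ => (funext hx : _ = fun j => (x j : ℕ)) ▸ h, fun h => ⟨_, h, fun _ => rfl⟩⟩

theorem eq_of_isLim_fin {k : ℕ} {p : Baire} {x x' : ℕ → Fin k} (h : IsLim p fun j => x j)
    (h' : IsLim p fun j => x' j) : x = x' :=
  funext fun j => Fin.ext (congrFun (h.unique h') j)

theorem mem_iff_of_indicator_eq {M N : Set ℕ} {i : ℕ}
    (h : M.indicator (1 : Baire) i = N.indicator (1 : Baire) i) : i ∈ M ↔ i ∈ N := by
  by_cases h1 : i ∈ M <;> by_cases h2 : i ∈ N <;> simp_all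

theorem indicator_congr {M N : Set ℕ} {n : ℕ} (h : ∀ i < n, i ∈ M ↔ i ∈ N) :
    ∀ i < n, M.indicator (1 : Baire) i = N.indicator (1 : Baire) i := fun i hi => by
  by_cases hN : i ∈ N <;> simp [hN, h i hi]

/-! ### Weihrauch incomparability of the jumps -/

theorem not_weihrauchReducible_BWT_jump_RT_jump :
    ¬ WeihrauchReducible (BWT 2).jump (RT 1 2).jump := by
  intro h
  obtain ⟨H, K, hH, hK, h⟩ := h.exists_locallyDetermined
  have key : ∀ p, NamesBinaryLimit p → ∃ s c, s ∈ K p ∧ IsLim s (fun j => (c j : Fin 2)) ∧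
      ∀ M b, InfMono c M b → ∃ t a, t ∈ H (bairePair p (M.indicator 1)) ∧ t 0 = (a : Fin 2) ∧
        ∀ x : ℕ → Fin 2, IsLim p (fun k => x k) → ∃ᶠ k in atTop, x k = a := by
    rintro p ⟨x, hx⟩
    obtain ⟨s, hs, w, hw, -, hsol⟩ := h p x (BWT_jump_names_iff.2 hx) (BWT_sol_nonempty x)
    refine ⟨s, w.toSeq, hs, RT_one_jump_names_iff.1 hw, fun M b hM => ?_⟩
    obtain ⟨t, ht, a, ha, hta⟩ := hsol M hM.mem_RT_sol _ rfl
    refine ⟨t, a, ht, hta, fun x' hx' => ?_⟩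
    rw [eq_of_isLim_fin hx' hx]
    exact mapClusterPt_iff_frequently_eq.1 ha
  choose! F c hFK hlim t A ht htA hA using key
  refine false_of_clusterPt_from_mono (F := F) (c := c) (A := A) hlim ?_
    (fun p x M b hx hM => hA p ⟨x, hx⟩ M b hM x hx) ?_
  · intro p hp m
    obtain ⟨n, hn⟩ := hK _ _ (hFK p hp) (m + 1)
    exact ⟨n, fun p' hp' hpp' => hn p' _ hpp' (hFK p' hp') m m.lt_succ_self⟩
  · intro p M b hp hM
    obtain ⟨n, hn⟩ := hH _ _ (ht p hp M b hM) 1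
    -- The answer is the first value of `H`, which sees `M` but not its color.
    refine ⟨n, fun p' M' b' hp' hM' hpp' hMM' => Fin.ext ?_⟩
    rw [← htA p hp M b hM, ← htA p' hp' M' b' hM']
    exact hn _ _ (bairePair_congr hpp' (indicator_congr hMM')) (ht p' hp' M' b' hM') 0 one_pos

theorem not_weihrauchReducible_RT_jump_BWT_jump :
    ¬ WeihrauchReducible (RT 1 2).jump (BWT 2).jump := by
  intro h
  obtain ⟨H, K, hH, -, h⟩ := h.exists_locallyDetermined
  let nm : (ℕ → Fin 2 × ℕ × ℕ) → Baire := fun z => limName (fun k => (z k).1) (fun k => (z k).2)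
  let S : Fin 2 × Fin 2 → Set (ℕ → Fin 2 × ℕ × ℕ) := fun q =>
    {z | ∃ M : Set ℕ, InfMono (fun k => (z k).1) M q.2 ∧
      M.indicator 1 ∈ H (bairePair (nm z) fun _ => q.1)}
  have hS : ⋃ q, closure (S q) = Set.univ := by
    refine Set.eq_univ_of_forall fun z => ?_
    obtain ⟨s, -, w, -, ⟨a, ha⟩, hsol⟩ := h (nm z) (coloringOfSeq fun k => (z k).1)
      (RT_one_jump_names_iff.2 (by rw [toSeq_coloringOfSeq]; exact isLim_limName _ _))
      (RT_one_sol_nonempty _)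
    obtain ⟨t, ht, M, ⟨hM, hMh⟩, rfl⟩ := hsol a ha (fun _ => a) rfl
    obtain ⟨b, hb⟩ := isHomogeneous_one_iff.1 hMh
    rw [toSeq_coloringOfSeq] at hb
    exact Set.mem_iUnion.2 ⟨(a, b), subset_closure ⟨M, ⟨hM, hb⟩, ht⟩⟩
  obtain ⟨⟨a, b⟩, z₀, hz₀⟩ := nonempty_interior_of_iUnion_of_closed (fun q => isClosed_closure) hS
  obtain ⟨z, hz, M, ⟨hM, hMb⟩, hMH⟩ :=
    mem_closure_iff.1 (interior_subset hz₀) _ isOpen_interior hz₀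
  obtain ⟨l, hl⟩ := exists_agree_subset_of_isOpen isOpen_interior hz
  -- Every position in column `j` is at least `j > l`, so changes there respect the condition of
  -- length `l`.
  obtain ⟨j, hjM, hlj⟩ := hM.exists_gt l
  obtain ⟨n, hn⟩ := hH _ _ hMH (j + 1)
  obtain ⟨b', hb'⟩ := exists_ne_fin_two b
  -- the same name up to `n`, but another color of `j`
  let z' : ℕ → Fin 2 × ℕ × ℕ := fun k =>
    (if k = j then b' else (z k).1, if k = j then n else (z k).2.1,
      if k.unpair.2 = j then nm z k else (z k).2.2)
  have hz' : ∀ k < l, z' k = z k := fun k hk => by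
    have h1 : k ≠ j := by omega
    have h2 : k.unpair.2 ≠ j := by have := Nat.unpair_right_le k; omega
    simp [z', h1, h2]
  have hname : ∀ k < n, nm z' k = nm z k := by
    intro k hk
    by_cases hkj : k.unpair.2 = j
    · simp [nm, limName, z', hkj, not_le.2 hk]
    · simp [nm, limName, z', hkj]
  -- Agreement up to `n` preserves the decision to include `j`, and agreement up to `j + 1`
  -- preserves its new color.
  obtain ⟨z'', hz'', M', ⟨-, hMb'⟩, hMH'⟩ := mem_closure_iff.1 (interior_subset (hl z' hz')) _
    (isOpen_setOf_agree z' (max n (j + 1))) fun _ _ => rfl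
  have hname' : ∀ k < n, nm z'' k = nm z k := fun k hk => by
    have hlt : ∀ k < n, z'' k = z' k := fun k hk => hz'' k (hk.trans_le (le_max_left _ _))
    rw [← hname k hk]
    exact limName_congr (fun i hi => by rw [hlt i hi]) (fun i hi => by rw [hlt i hi]) k hk
  have hj := hn _ _ (bairePair_congr hname' fun _ _ => rfl) hMH' j j.lt_succ_self
  have h1 := hMb' j ((mem_iff_of_indicator_eq hj).2 hjM)
  have h2 : (z'' j).1 = b' := by
    rw [hz'' j (lt_of_lt_of_le j.lt_succ_self (le_max_right _ _))]
    simp [z']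
  exact hb' (h2.symm.trans h1)

/-! ### Strong Weihrauch incomparability -/

theorem not_stronglyWeihrauchReducible_BWT_RT :
    ¬ StronglyWeihrauchReducible (BWT 2) (RT 1 2) := by
  intro h
  obtain ⟨H, K, h⟩ := h.exists_forall
  have key : ∀ a : Fin 2, ∃ w : Coloring 1 2, ∀ M ∈ (RT 1 2).sol w,
      ∃ t ∈ H (M.indicator 1), t 0 = a := by
    intro a
    obtain ⟨s, -, w, -, -, hsol⟩ := h (fun _ => a) (fun _ => a) (fun _ => rfl)
      (BWT_sol_nonempty _)
    refine ⟨w, fun M hM => ?_⟩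
    obtain ⟨t, ht, a', ha', hta⟩ := hsol M hM _ rfl
    obtain ⟨-, rfl⟩ := (mapClusterPt_iff_frequently_eq.1 ha').exists
    exact ⟨t, ht, hta⟩
  obtain ⟨w₀, h₀⟩ := key 0
  obtain ⟨w₁, h₁⟩ := key 1
  -- a common infinite homogeneous set
  obtain ⟨M, b, hM, -⟩ := exists_infMono w₀.toSeq 0
  obtain ⟨b', hM'⟩ := exists_infinite_color hM.1 w₁.toSeq
  have hN₀ : InfMono w₀.toSeq {j ∈ M | w₁.toSeq j = b'} b := ⟨hM', fun j hj => hM.2 j hj.1⟩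
  have hN₁ : InfMono w₁.toSeq {j ∈ M | w₁.toSeq j = b'} b' := ⟨hM', fun j hj => hj.2⟩
  obtain ⟨t, ht, ht0⟩ := h₀ _ hN₀.mem_RT_sol
  obtain ⟨t', ht', ht1⟩ := h₁ _ hN₁.mem_RT_sol
  obtain rfl := Part.mem_unique ht ht'
  simp [ht0] at ht1

theorem exists_seq_not_constant {M N : Set ℕ} (hM : M.Infinite) (hN : N.Infinite) :
    ∃ x : ℕ → Fin 2, ∀ b, (∃ i ∈ M, x i ≠ b) ∧ ∃ i ∈ N, x i ≠ b := by
  obtain ⟨m, hm⟩ := hM.nonempty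
  obtain ⟨n, hn⟩ := hN.nonempty
  obtain ⟨m', hm', h1⟩ := hM.exists_notMem_finset {m, n}
  obtain ⟨n', hn', h2⟩ := hN.exists_notMem_finset {m, n}
  simp only [Finset.mem_insert, Finset.mem_singleton, not_or] at h1 h2
  refine ⟨fun i => if i = m ∨ i = n then 0 else 1, fun b => ?_⟩
  by_cases hb : b = 0
  · exact ⟨⟨m', hm', by simp [h1, hb]⟩, n', hn', by simp [h2, hb]⟩
  · exact ⟨⟨m, hm, by simpa using Ne.symm hb⟩, n, hn, by simpa using Ne.symm hb⟩

theorem not_stronglyWeihrauchReducible_RT_BWT :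
    ¬ StronglyWeihrauchReducible (RT 1 2) (BWT 2) := by
  intro h
  obtain ⟨H, K, h⟩ := h.exists_forall
  have hM : ∀ a : Fin 2, ∃ M : Set ℕ, M.Infinite ∧
      ∀ N : Set ℕ, N.Infinite → N.indicator 1 ∈ H (fun _ => a) → N = M := by
    intro a
    by_cases hex : ∃ M : Set ℕ, M.Infinite ∧ M.indicator 1 ∈ H (fun _ => a)
    · obtain ⟨M, hM, hMH⟩ := hex
      exact ⟨M, hM, fun N _ hN =>
        Set.ext fun i => mem_iff_of_indicator_eq (congrFun (Part.mem_unique hN hMH) i)⟩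
    · exact ⟨Set.univ, Set.infinite_univ, fun N hN hNH => absurd ⟨N, hN, hNH⟩ hex⟩
  choose M hM hMH using hM
  obtain ⟨x, hx⟩ := exists_seq_not_constant (hM 0) (hM 1)
  obtain ⟨s, -, w, -, ⟨a, ha⟩, hsol⟩ := h _ (coloringOfSeq x)
    (coloringRep_one_names_iff.2 rfl) (RT_one_sol_nonempty _)
  obtain ⟨t, ht, N, ⟨hN, hNh⟩, rfl⟩ := hsol a ha (fun _ => a) rfl
  obtain rfl := hMH a N hN ht
  obtain ⟨b, hb⟩ := isHomogeneous_one_iff.1 hNh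
  rw [toSeq_coloringOfSeq] at hb
  obtain ⟨⟨i, hi, hib⟩, j, hj, hjb⟩ := hx b
  match a with
  | 0 => exact hib (hb i hi)
  | 1 => exact hjb (hb j hj)

/-! ### Stable Ramsey's theorem for pairs -/

/-- The coloring of pairs `i < j` that approximates in stage `j` the limit of the `i`-th column
of `p`. -/
def pairColoring (p : Baire) : Coloring 2 2 := fun A =>
  if p (Nat.pair (A.1.sup id) (A.1.sum id - A.1.sup id)) = 0 then 0 else 1

theorem pairColoring_apply (p : Baire) {i j : ℕ} (hij : i < j) (h : ({j, i} : Finset ℕ).card = 2) :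
    pairColoring p ⟨{j, i}, h⟩ = if p (Nat.pair j i) = 0 then 0 else 1 := by
  have h1 : ({j, i} : Finset ℕ).sup id = j := by simp [hij.le]
  have h2 : ({j, i} : Finset ℕ).sum id = j + i := Finset.sum_pair hij.ne'
  simp only [pairColoring, h1, h2, Nat.add_sub_cancel_left]

theorem eventually_pairColoring {p : Baire} {x : ℕ → Fin 2} (h : IsLim p fun k => x k) (i : ℕ) :
    ∀ᶠ j in atTop, ∀ h : ({j, i} : Finset ℕ).card = 2, pairColoring p ⟨{j, i}, h⟩ = x i := by
  filter_upwards [h i, eventually_gt_atTop i] with j hj hij hcard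
  rw [pairColoring_apply p hij, hj]
  generalize x i = a
  fin_cases a <;> rfl

theorem isStable_pairColoring {p : Baire} {x : ℕ → Fin 2} (h : IsLim p fun k => x k) :
    IsStable (pairColoring p) := by
  intro A hA
  obtain ⟨i, rfl⟩ := Finset.card_eq_one.1 (Nat.succ_injective hA)
  exact ⟨x i, eventually_pairColoring h i⟩

/-- Among the infinitely many columns with the same limit, choose greedily a column so late that its
pairs with all earlier choices show their limit color. -/
theorem SRT_sol_pairColoring_nonempty {p : Baire} {x : ℕ → Fin 2} (h : IsLim p fun k => x k) :
    ((SRT 2 2).sol (pairColoring p)).Nonempty := by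
  obtain ⟨b, hb⟩ := exists_infinite_color Set.infinite_univ x
  obtain ⟨m, hm, hlt⟩ := exists_seq_of_forall_finset_exists (fun i => x i = b)
    (fun i j => i < j ∧ ∀ h : ({j, i} : Finset ℕ).card = 2, pairColoring p ⟨{j, i}, h⟩ = b) (by
      intro s hs
      have h1 : ∀ᶠ j in atTop, ∀ i ∈ s, i < j ∧
          ∀ h : ({j, i} : Finset ℕ).card = 2, pairColoring p ⟨{j, i}, h⟩ = b := by
        refine (Filter.eventually_all_finset s).2 fun i hi => (eventually_gt_atTop i).and ?_
        rw [← hs i hi]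
        exact eventually_pairColoring h i
      have h2 : ∃ᶠ j in atTop, x j = b := Nat.frequently_atTop_iff_infinite.2 (by simpa using hb)
      exact (h2.and_eventually h1).exists)
  have hmono : StrictMono m := fun i j hij => (hlt i j hij).1
  refine ⟨Set.range m, isStable_pairColoring h, Set.infinite_range_of_injective hmono.injective,
    b, ?_⟩
  rintro ⟨A, hA⟩ hAm
  obtain ⟨u, v, huv, rfl⟩ := Finset.card_eq_two.1 hA
  obtain ⟨i, rfl⟩ := hAm (a := u) (by simp)
  obtain ⟨j, rfl⟩ := hAm (a := v) (by simp)
  rcases lt_or_gt_of_ne (fun h => huv (congrArg m h) : i ≠ j) with hij | hij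
  · have h1 := (hlt i j hij).2
    simp only [Finset.pair_comm (m j)] at h1
    exact h1 hA
  · exact (hlt j i hij).2 hA

/-- The name of `pairColoring p`. -/
def pairColoringName (p : Baire) : Baire := fun e =>
  pairColoring p ⟨tupleSet 2 e, card_tupleSet 2 e⟩

theorem pairColoringName_congr (p : Baire) (n : ℕ) :
    ∃ m, ∀ p' : Baire, (∀ i < m, p' i = p i) →
      ∀ i < n, pairColoringName p' i = pairColoringName p i := by
  let q : ℕ → ℕ := fun e =>
    Nat.pair ((tupleSet 2 e).sup id) ((tupleSet 2 e).sum id - (tupleSet 2 e).sup id)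
  refine ⟨(Finset.range n).sup q + 1, fun p' hp e he => ?_⟩
  have h : p' (q e) = p (q e) :=
    hp _ (Nat.lt_succ_of_le (Finset.le_sup (Finset.mem_range.2 he)))
  simp only [pairColoringName, pairColoring]
  rw [show p' (Nat.pair _ _) = p (Nat.pair _ _) from h]

/-- The color of an infinite homogeneous set for `pairColoring p` is the limit at each of its
elements, hence a cluster point, and it can be read off `p` from two elements. Thus
`false_of_clusterPt_from_mono` applies. -/
theorem not_weihrauchReducible_SRT_RT_jump :
    ¬ WeihrauchReducible (SRT 2 2) (RT 1 2).jump := by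
  intro h
  obtain ⟨H, K, hH, hK, h⟩ := h.exists_locallyDetermined
  have key : ∀ p, NamesBinaryLimit p → ∃ s c, s ∈ K (pairColoringName p) ∧
      IsLim s (fun j => (c j : Fin 2)) ∧ ∀ M b, InfMono c M b → ∃ (N : Set ℕ) (a : Fin 2),
        N.indicator 1 ∈ H (bairePair (pairColoringName p) (M.indicator 1)) ∧ N.Infinite ∧
        ∀ i ∈ N, ∀ j ∈ N, i < j → (if p (Nat.pair j i) = 0 then 0 else 1) = a := by
    rintro p ⟨x, hx⟩
    obtain ⟨s, hs, w, hw, -, hsol⟩ := h (pairColoringName p) (pairColoring p) (fun _ => rfl)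
      (SRT_sol_pairColoring_nonempty hx)
    refine ⟨s, w.toSeq, hs, RT_one_jump_names_iff.1 hw, fun M b hM => ?_⟩
    obtain ⟨t, ht, N, ⟨-, hN, a, ha⟩, rfl⟩ := hsol M hM.mem_RT_sol _ rfl
    refine ⟨N, a, ht, hN, fun i hi j hj hij => ?_⟩
    rw [← pairColoring_apply p hij (Finset.card_pair hij.ne')]
    refine ha ⟨{j, i}, _⟩ fun k hk => ?_
    simp only [Finset.coe_insert, Finset.coe_singleton, Set.mem_insert_iff,
      Set.mem_singleton_iff] at hk
    rcases hk with rfl | rfl <;> assumption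
  choose! F c hFK hlim N A hN hNinf hA using key
  refine false_of_clusterPt_from_mono (F := F) (c := c) (A := A) hlim ?_ ?_ ?_
  · intro p hp m
    obtain ⟨n, hn⟩ := hK _ _ (hFK p hp) (m + 1)
    obtain ⟨l, hl⟩ := pairColoringName_congr p n
    exact ⟨l, fun p' hp' hpp' => hn _ _ (hl p' hpp') (hFK p' hp') m m.lt_succ_self⟩
  · intro p x M b hx hM
    have hp : NamesBinaryLimit p := ⟨x, hx⟩
    refine Nat.frequently_atTop_iff_infinite.2 ((hNinf p hp M b hM).mono fun i hi => ?_)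
    obtain ⟨j, ⟨hjN, hij⟩, hj⟩ := ((Nat.frequently_atTop_iff_infinite.2
      (hNinf p hp M b hM)).and_eventually (eventually_gt_atTop i)).and_eventually
        (eventually_pairColoring hx i) |>.exists
    have h1 := hj (Finset.card_pair hij.ne')
    rw [pairColoring_apply p hij] at h1
    exact h1.symm.trans (hA p hp M b hM i hi j hjN hij)
  · intro p M b hp hM
    obtain ⟨i, hi⟩ := (hNinf p hp M b hM).nonempty
    obtain ⟨j, hj, hij⟩ := (hNinf p hp M b hM).exists_gt i
    obtain ⟨n, hn⟩ := hH _ _ (hN p hp M b hM) (j + 1)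
    obtain ⟨l, hl⟩ := pairColoringName_congr p n
    -- The last bound also fixes the entry of `p` from which the color of the pair is read.
    refine ⟨max (max n l) (Nat.pair j i + 1), fun p' M' b' hp' hM' hpp' hMM' => ?_⟩
    have h1 := hn _ _ (bairePair_congr
      (hl p' fun k hk => hpp' k (by omega))
      (indicator_congr fun k hk => hMM' k (by omega))) (hN p' hp' M' b' hM')
    have hi' := (mem_iff_of_indicator_eq (h1 i (by omega))).2 hi
    have hj' := (mem_iff_of_indicator_eq (h1 j (by omega))).2 hj
    rw [← hA p hp M b hM i hi j hj hij, ← hA p' hp' M' b' hM' i hi' j hj' hij,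
      hpp' _ (by omega)]

end WeihrauchRamsey

theorem theorem6p8 :
    ¬ WeihrauchRamsey.WeihrauchReducible
        (WeihrauchRamsey.BWT 2).jump (WeihrauchRamsey.RT 1 2).jump ∧
    WeihrauchRamsey.WeihrauchIncomparable
        (WeihrauchRamsey.BWT 2).jump (WeihrauchRamsey.RT 1 2).jump ∧
    WeihrauchRamsey.StronglyWeihrauchIncomparable
        (WeihrauchRamsey.BWT 2) (WeihrauchRamsey.RT 1 2) ∧
    ¬ WeihrauchRamsey.WeihrauchReducible
        (WeihrauchRamsey.SRT 2 2) (WeihrauchRamsey.D 2 2) :=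
  ⟨WeihrauchRamsey.not_weihrauchReducible_BWT_jump_RT_jump,
    ⟨WeihrauchRamsey.not_weihrauchReducible_BWT_jump_RT_jump,
      WeihrauchRamsey.not_weihrauchReducible_RT_jump_BWT_jump⟩,
    ⟨WeihrauchRamsey.not_stronglyWeihrauchReducible_BWT_RT,
      WeihrauchRamsey.not_stronglyWeihrauchReducible_RT_BWT⟩,
    -- `D 2 2` unfolds to `(RT 1 2).jump`.
    WeihrauchRamsey.not_weihrauchReducible_SRT_RT_jump⟩
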